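/- Let $n$ and $d$ be integers with $d \ge 1$ and $n \ge 2d+2$, and let $k$ be a field. Let $G = C_n(d+1, d+2, \ldots, \lfloor n/2 \rfloor)$ be the circulant graph on the vertex set $\{0, 1, \ldots, n-1\}$ in which $\{a,b\}$ is an edge if and only if $|a-b|$ or $n-|a-b|$ lies in $\{d+1, d+2, \ldots, \lfloor n/2 \rfloor\}$. Then the following are equivalent: (i) $G$ is Buchsbaum (over $k$); (ii) $G$ is well-covered, i.e. all minimal vertex covers of $G$ have the same cardinality; (iii) $n > 3d$ or $n = 2d+2$. Furthermore, each of the three properties "$G$ is vertex decomposable", "$G$ is shellable" and "$G$ is Cohen–Macaulay (over $k$)" holds if and only if $n = 2d+2$, or $d = 1$ and $n > 3$. Here $G$ is called Buchsbaum, vertex decomposable, shellable or Cohen–Macaulay if its independence complex ${\rm Ind}(G)$, the simplicial complex of all independent sets of $G$, has that property, and for a simplicial complex $\Delta$ on a finite vertex set (with $\emptyset \in \Delta$) the properties are defined as follows. The dimension of a face $F$ is $|F|-1$, and $\dim \Delta$ is the maximum of these; $\Delta$ is pure if all its facets (maximal faces) have the same dimension; ${\rm link}_\Delta(F) = \{H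 \in \Delta : F \cap H = \emptyset,\ F \cup H \in \Delta\}$ for $F \in \Delta$, and ${\rm del}_\Delta(x) = \{H \in \Delta : x \notin H\}$ for a vertex $x$ of $\Delta$; for a vertex one writes ${\rm link}_\Delta(x)$ for ${\rm link}_\Delta(\{x\})$. All four properties require $\Delta$ to be pure. A pure complex $\Delta$ is - vertex decomposable if it is a simplex (all subsets of its vertex set are faces), or if, recursively, it has a vertex $x$ such that ${\rm link}_\Delta(x)$ and ${\rm del}_\Delta(x)$ are vertex decomposable; - shellable if its facets can be ordered $F_1 < \cdots < F_t$ so that for all $1 \le j < i \le t$ there are $x \in F_i \setminus F_j$ and $l \in \{1, \ldots, i-1\}$ with $F_i \setminus F_l = \{x\}$; - Cohen–Macaulay over $k$ if $\tilde H_i({\rm link}_\Delta(F); k) = 0$ for every $F \in \Delta$ and every $i < \dim {\rm link}_\Delta(F)$, where $\tilde H_i$ is reduced simplicial homology; - Buchsbaum over $k$ if ${\rm link}_\Delta(x)$ is Cohen–Macaulay over $k$ for every vertex $x$ of $\Delta$. -/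

import Mathlib

/-- A simplicial complex with finitely many faces, all of them finite sets of elements of `V`:
a family of finite sets closed under taking subsets and containing the empty set.  Its vertices are
the `x` with `{x}` a face; not every element of `V` has to be a vertex, so that links and deletions
are again complexes over the same type `V`.  (Mathlib's `AbstractSimplicialComplex` leaves out the
empty face and makes every element of the type a vertex.) -/
@[ext]
structure FinSimplicialComplex (V : Type*) where
  /-- the faces, including the empty one -/
  faces : Finset (Finset V)
  empty_mem : ∅ ∈ faces
  down_closed : ∀ ⦃F G : Finset V⦄, F ∈ faces → G ⊆ F → G ∈ faces

namespace FinSimplicialComplex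

section Combinatorial

variable {V : Type*}

/-- A facet is a face that is maximal with respect to inclusion. -/
def IsFacet (Δ : FinSimplicialComplex V) (F : Finset V) : Prop :=
  Maximal (fun G => G ∈ Δ.faces) F

/-- All facets have the same dimension. -/
def IsPure (Δ : FinSimplicialComplex V) : Prop :=
  ∀ ⦃F G : Finset V⦄, Δ.IsFacet F → Δ.IsFacet G → F.card = G.card

/-- The dimension, i.e. the maximum of `|F| - 1` over the faces `F`; it is `-1` for the complex
whose only face is the empty set. -/
def dim (Δ : FinSimplicialComplex V) : ℤ :=
  (Δ.faces.sup Finset.card : ℕ) - 1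

/-- A simplex: the faces are all the subsets of one finite set (of the set of all vertices). -/
def IsSimplex (Δ : FinSimplicialComplex V) : Prop :=
  ∃ F : Finset V, Δ.faces = F.powerset

/-- Shellability of a pure complex: the facets can be listed without repetition as
`F 0, F 1, …` so that for all `j < i` there are `x ∈ F i \ F j` and `k < i` with
`F i \ F k = {x}`. -/
def IsShellable [DecidableEq V] (Δ : FinSimplicialComplex V) : Prop :=
  Δ.IsPure ∧
    ∃ (t : ℕ) (F : Fin t → Finset V), Function.Injective F ∧
      (∀ G : Finset V, Δ.IsFacet G ↔ ∃ i, F i = G) ∧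
      ∀ i j : Fin t, j < i → ∃ x ∈ F i \ F j, ∃ k < i, F i \ F k = {x}

/-- The link of a face `F`: the faces `G` disjoint from `F` such that `F ∪ G` is a face. -/
def link [DecidableEq V] (Δ : FinSimplicialComplex V) (F : Finset V) (hF : F ∈ Δ.faces) :
    FinSimplicialComplex V where
  faces := Δ.faces.filter fun G => F ∩ G = ∅ ∧ F ∪ G ∈ Δ.faces
  empty_mem := by simp [Δ.empty_mem, hF]
  down_closed := by
    intro G H hG hHG
    rw [Finset.mem_filter] at hG ⊢
    refine ⟨Δ.down_closed hG.1 hHG, ?_, Δ.down_closed hG.2.2 (Finset.union_subset_union_right hHG)⟩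
    exact Finset.subset_empty.1 (hG.2.1 ▸ Finset.inter_subset_inter_left hHG)

/-- The deletion of a vertex `x`: the faces that do not contain `x`. -/
def deletion [DecidableEq V] (Δ : FinSimplicialComplex V) (x : V) : FinSimplicialComplex V where
  faces := Δ.faces.filter fun G => x ∉ G
  empty_mem := by simp [Δ.empty_mem]
  down_closed := by
    intro G H hG hHG
    rw [Finset.mem_filter] at hG ⊢
    exact ⟨Δ.down_closed hG.1 hHG, fun hx => hG.2 (hHG hx)⟩

/-- Vertex decomposability of a pure complex, defined recursively (a simplex is pure). -/
inductive IsVertexDecomposable [DecidableEq V] : FinSimplicialComplex V → Prop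
  | simplex (Δ : FinSimplicialComplex V) (h : Δ.IsSimplex) : IsVertexDecomposable Δ
  | shed (Δ : FinSimplicialComplex V) (hpure : Δ.IsPure) (x : V) (hx : {x} ∈ Δ.faces)
      (hlink : IsVertexDecomposable (Δ.link {x} hx))
      (hdel : IsVertexDecomposable (Δ.deletion x)) : IsVertexDecomposable Δ

end Combinatorial

section Homology

variable (K : Type*) [Field K] {V : Type*} [LinearOrder V]

/-- The simplicial boundary map on formal linear combinations of finite sets.  If
`F = {x₀ < x₁ < … < xᵢ}`, then `∂ F = ∑ j, (-1) ^ j • (F \ {xⱼ})`; in particular the boundary of a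
one-element set is the empty set, and the boundary of the empty set is `0`. -/
noncomputable def boundary : (Finset V →₀ K) →ₗ[K] (Finset V →₀ K) :=
  Finsupp.linearCombination K fun F =>
    ∑ x ∈ F, Finsupp.single (F.erase x) ((-1 : K) ^ (F.filter (· < x)).card)

theorem boundary_single (F : Finset V) :
    boundary K (Finsupp.single F 1) =
      ∑ x ∈ F, Finsupp.single (F.erase x) ((-1 : K) ^ (F.filter (· < x)).card) := by
  simp [boundary]

theorem boundary_boundary (c : Finset V →₀ K) : boundary K (boundary K c) = 0 := by
  suffices h : boundary K ∘ₗ boundary K = (0 : (Finset V →₀ K) →ₗ[K] (Finset V →₀ K)) from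
    LinearMap.congr_fun h c
  refine Finsupp.lhom_ext' fun F => LinearMap.ext_ring ?_
  simp only [LinearMap.comp_apply, Finsupp.lsingle_apply, boundary_single, map_sum,
    LinearMap.zero_apply]
  have key : ∀ x : V, boundary K (Finsupp.single (F.erase x)
      ((-1 : K) ^ (F.filter (· < x)).card)) = ∑ y ∈ F.erase x, Finsupp.single
        ((F.erase x).erase y) ((-1 : K) ^ (F.filter (· < x)).card *
          (-1 : K) ^ ((F.erase x).filter (· < y)).card) := by
    intro x
    rw [← mul_one ((-1 : K) ^ (F.filter (· < x)).card), ← smul_eq_mul, ← Finsupp.smul_single,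
      map_smul, boundary_single, Finset.smul_sum]
    simp
  simp only [key]
  rw [Finset.sum_sigma']
  -- For `x < y` in `F`, the terms that remove `x, y` in the two orders cancel.
  have cancel : ∀ x ∈ F, ∀ y ∈ F, x < y →
      (-1 : K) ^ (F.filter (· < x)).card * (-1 : K) ^ ((F.erase x).filter (· < y)).card +
      (-1 : K) ^ (F.filter (· < y)).card * (-1 : K) ^ ((F.erase y).filter (· < x)).card = 0 := by
    intro x hx y hy hxy
    have h1 : ((F.erase y).filter (· < x)) = F.filter (· < x) := by
      ext z
      simp only [Finset.mem_filter, Finset.mem_erase]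
      exact ⟨fun h => ⟨h.1.2, h.2⟩, fun h => ⟨⟨(h.2.trans hxy).ne, h.1⟩, h.2⟩⟩
    have h2 : (F.filter (· < y)).card = ((F.erase x).filter (· < y)).card + 1 := by
      rw [Finset.filter_erase, Finset.card_erase_add_one]
      simp [hx, hxy]
    rw [h1, h2, pow_succ]
    ring
  refine Finset.sum_involution (fun p _ => ⟨p.2, p.1⟩) ?_ ?_ ?_ ?_
  · rintro ⟨x, y⟩ hp
    simp only [Finset.mem_sigma, Finset.mem_erase] at hp
    dsimp only
    rw [Finset.erase_right_comm, ← Finsupp.single_add]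
    rcases lt_or_gt_of_ne hp.2.1 with h | h
    · rw [add_comm, cancel y hp.2.2 x hp.1 h, Finsupp.single_zero]
    · rw [cancel x hp.1 y hp.2.2 h, Finsupp.single_zero]
  · rintro ⟨x, y⟩ hp - h
    simp only [Finset.mem_sigma, Finset.mem_erase] at hp
    exact hp.2.1 (congrArg Sigma.fst h)
  · rintro ⟨x, y⟩ hp
    simp only [Finset.mem_sigma, Finset.mem_erase] at hp ⊢
    exact ⟨hp.2.2, hp.2.1.symm, hp.1⟩
  · rintro ⟨x, y⟩ hp
    rfl

variable (Δ : FinSimplicialComplex V)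

/-- The `i`-th augmented simplicial chains of `Δ`: linear combinations of the faces of
dimension `i` (so of the empty face for `i = -1`). -/
def chains (i : ℤ) : Submodule K (Finset V →₀ K) :=
  Finsupp.supported K K {F | F ∈ Δ.faces ∧ (F.card : ℤ) - 1 = i}

/-- The `i`-cycles of the augmented chain complex of `Δ`. -/
noncomputable def cycles (i : ℤ) : Submodule K (Finset V →₀ K) :=
  chains K Δ i ⊓ LinearMap.ker (boundary K)

/-- The `i`-boundaries of the augmented chain complex of `Δ`. -/
noncomputable def boundaries (i : ℤ) : Submodule K (Finset V →₀ K) :=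
  (chains K Δ (i + 1)).map (boundary K)

theorem boundaries_le_cycles (i : ℤ) : boundaries K Δ i ≤ cycles K Δ i := by
  rintro _ ⟨c, hc, rfl⟩
  refine ⟨?_, boundary_boundary K c⟩
  rw [SetLike.mem_coe, chains, Finsupp.mem_supported] at hc
  rw [boundary, Finsupp.linearCombination_apply]
  refine Submodule.sum_mem _ fun F hF => Submodule.smul_mem _ _ (Submodule.sum_mem _ fun x hx => ?_)
  refine Finsupp.single_mem_supported K _ ?_
  obtain ⟨h1, h2⟩ := hc hF
  refine ⟨Δ.down_closed h1 (Finset.erase_subset x F), ?_⟩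
  have := Finset.card_erase_add_one hx
  omega

/-- The quotient `Z / B` for submodules `B ≤ Z` of a module (`B ⊓ Z` takes the place of `B` in
general). -/
abbrev Subquotient {R M : Type*} [Ring R] [AddCommGroup M] [Module R M] (Z B : Submodule R M) :
    Type _ :=
  Z ⧸ B.submoduleOf Z

/-- The `i`-th reduced simplicial homology of `Δ` with coefficients in `K`: cycles modulo
boundaries of the augmented chain complex. -/
abbrev ReducedHomology (i : ℤ) : Type _ :=
  Subquotient (cycles K Δ i) (boundaries K Δ i)

/-- Cohen–Macaulayness over `K` of a pure complex: the reduced homology of the link of every face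
vanishes below the dimension of this link. -/
def IsCohenMacaulay (K : Type*) [Field K] (Δ : FinSimplicialComplex V) : Prop :=
  Δ.IsPure ∧
    ∀ (F : Finset V) (hF : F ∈ Δ.faces) (i : ℤ), i < (Δ.link F hF).dim →
      Subsingleton (ReducedHomology K (Δ.link F hF) i)

/-- Buchsbaumness over `K` of a pure complex: the link of every vertex is Cohen–Macaulay. -/
def IsBuchsbaum (K : Type*) [Field K] (Δ : FinSimplicialComplex V) : Prop :=
  Δ.IsPure ∧ ∀ (x : V) (hx : {x} ∈ Δ.faces), IsCohenMacaulay K (Δ.link {x} hx)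

end Homology

end FinSimplicialComplex

namespace SimpleGraph

/-- A finite graph is well-covered if all its minimal vertex covers have the same cardinality. -/
def IsWellCovered {V : Type*} [Fintype V] (G : SimpleGraph V) : Prop :=
  ∀ ⦃C D : Finset V⦄, Minimal (fun W : Finset V => G.IsVertexCover (W : Set V)) C →
    Minimal (fun W : Finset V => G.IsVertexCover (W : Set V)) D → C.card = D.card

open Classical in
/-- The independence complex: its faces are the independent sets of vertices. -/
noncomputable def independenceComplex {V : Type*} [Fintype V] (G : SimpleGraph V) :
    FinSimplicialComplex V where
  faces := Finset.univ.filter fun W : Finset V => G.IsIndepSet (W : Set V)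
  empty_mem := by simp
  down_closed := by
    intro F W hF hWF
    rw [Finset.mem_filter] at hF ⊢
    exact ⟨Finset.mem_univ _, hF.2.mono (Finset.coe_subset.2 hWF)⟩

/-- The circulant graph `C_n(S)` on `{0, …, n - 1}`: distinct `a` and `b` are adjacent if and only
if `|a - b| ∈ S` or `n - |a - b| ∈ S`.  (For `S ⊆ {1, …, ⌊n / 2⌋}`, as usual, the condition that
`a` and `b` are distinct is automatic.) -/
def circulant (n : ℕ) (S : Set ℕ) : SimpleGraph (Fin n) where
  Adj a b := a ≠ b ∧
    (((a : ℤ) - (b : ℤ)).natAbs ∈ S ∨ n - ((a : ℤ) - (b : ℤ)).natAbs ∈ S)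
  symm := ⟨by
    intro a b h
    rwa [ne_comm, ← Int.natAbs_neg, neg_sub] at h⟩
  loopless := ⟨fun a h => h.1 rfl⟩

end SimpleGraph

/-!
If `3 * d < n`, the facets of the independence complex are the arcs of `d + 1` consecutive vertices,
so the complex is pure. The facets of the link of a vertex are then a window sliding along a line,
which makes the link vertex decomposable and the complex Buchsbaum. For `d = 1` the same holds for
the deletion of a vertex, while for `d ≥ 2` the circle `0, 1, …, n - 1, 0` has winding number `±1`,
whereas boundaries have winding number `0`; hence the first homology does not vanish. If
`n = 2 * d + 2`, the complex is the boundary of a cross-polytope. For the remaining `n`, the arcs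
are facets, but so is a smaller set of vertices.
-/

namespace FinSimplicialComplex

section Faces

variable {V : Type*} {Δ : FinSimplicialComplex V} {F G : Finset V}

theorem exists_isFacet_superset (hG : G ∈ Δ.faces) : ∃ F, Δ.IsFacet F ∧ G ⊆ F := by
  obtain ⟨F, hGF, hF⟩ := Δ.faces.exists_le_maximal hG
  exact ⟨F, hF, hGF⟩

theorem isPure_of_forall_exists_superset_card_eq {m : ℕ}
    (h : ∀ G ∈ Δ.faces, ∃ F ∈ Δ.faces, G ⊆ F ∧ F.card = m) : Δ.IsPure := by
  have card_eq : ∀ G, Δ.IsFacet G → G.card = m := by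
    intro G hG
    obtain ⟨F, hF, hGF, hcard⟩ := h G hG.prop
    rwa [hG.eq_of_le hF hGF]
  intro F G hF hG
  rw [card_eq F hF, card_eq G hG]

theorem isFacet_iff_eq_of_faces_eq_powerset (h : Δ.faces = F.powerset) :
    Δ.IsFacet G ↔ F = G := by
  simp only [IsFacet, h, Finset.mem_powerset]
  constructor
  · exact fun hG => (hG.eq_of_le le_rfl hG.prop).symm
  · rintro rfl
    exact ⟨le_rfl, fun H hH _ => hH⟩

theorem IsPure.dim_eq (h : Δ.IsPure) (hF : Δ.IsFacet F) : Δ.dim = F.card - 1 := by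
  have hsup : Δ.faces.sup Finset.card = F.card := by
    refine le_antisymm (Finset.sup_le fun G hG => ?_) (Finset.le_sup hF.prop)
    obtain ⟨H, hH, hGH⟩ := exists_isFacet_superset hG
    exact (Finset.card_le_card hGH).trans (h hH hF).le
  rw [dim, hsup]

variable [DecidableEq V] {x : V}

theorem mem_deletion : G ∈ (Δ.deletion x).faces ↔ G ∈ Δ.faces ∧ x ∉ G := by
  rw [deletion, Finset.mem_filter]

theorem IsFacet.deletion (hG : Δ.IsFacet G) (hx : x ∉ G) : (Δ.deletion x).IsFacet G :=
  ⟨mem_deletion.2 ⟨hG.prop, hx⟩, fun _ hH hGH => hG.2 (mem_deletion.1 hH).1 hGH⟩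

theorem mem_link (hF : F ∈ Δ.faces) :
    G ∈ (Δ.link F hF).faces ↔ Disjoint F G ∧ F ∪ G ∈ Δ.faces := by
  rw [link, Finset.mem_filter, ← Finset.disjoint_iff_inter_eq_empty]
  exact ⟨fun h => h.2, fun h => ⟨Δ.down_closed h.2 Finset.subset_union_right, h⟩⟩

theorem isFacet_link (hF : F ∈ Δ.faces) :
    (Δ.link F hF).IsFacet G ↔ Disjoint F G ∧ Δ.IsFacet (F ∪ G) := by
  constructor
  · rintro ⟨hG, hmax⟩
    obtain ⟨hdisj, hface⟩ := (mem_link hF).1 hG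
    refine ⟨hdisj, hface, fun H hH hFGH => ?_⟩
    obtain ⟨hFH, hGH⟩ := Finset.union_subset_iff.1 hFGH
    have hsdiff : H \ F ∈ (Δ.link F hF).faces :=
      (mem_link hF).2 ⟨Finset.disjoint_sdiff, by rwa [Finset.union_sdiff_of_subset hFH]⟩
    have hle : H \ F ⊆ G := hmax hsdiff (Finset.subset_sdiff.2 ⟨hGH, hdisj.symm⟩)
    exact sdiff_le_iff.1 hle
  · rintro ⟨hdisj, hface, hmax⟩
    refine ⟨(mem_link hF).2 ⟨hdisj, hface⟩, fun H hH hGH => ?_⟩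
    obtain ⟨hdisj', hface'⟩ := (mem_link hF).1 hH
    have hle : F ∪ H ⊆ F ∪ G := hmax hface' (Finset.union_subset_union_right hGH)
    exact hdisj'.symm.left_le_of_le_sup_left (Finset.subset_union_right.trans hle)

theorem IsPure.link (h : Δ.IsPure) (hF : F ∈ Δ.faces) : (Δ.link F hF).IsPure := by
  intro G H hG hH
  obtain ⟨hFG, hG⟩ := (isFacet_link hF).1 hG
  obtain ⟨hFH, hH⟩ := (isFacet_link hF).1 hH
  have hcard := h hG hH
  rwa [Finset.card_union_of_disjoint hFG, Finset.card_union_of_disjoint hFH,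
    Nat.add_left_cancel_iff] at hcard

theorem link_empty : Δ.link ∅ Δ.empty_mem = Δ := by
  ext G
  simp [mem_link]

theorem union_mem_of_mem_link {hF : F ∈ Δ.faces} (hG : G ∈ (Δ.link F hF).faces) :
    F ∪ G ∈ Δ.faces :=
  ((mem_link hF).1 hG).2

theorem link_link (hF : F ∈ Δ.faces) (hG : G ∈ (Δ.link F hF).faces) :
    (Δ.link F hF).link G hG = Δ.link (F ∪ G) (union_mem_of_mem_link hG) := by
  ext H
  have hFG := ((mem_link hF).1 hG).1
  simp only [mem_link, Finset.disjoint_union_right, Finset.disjoint_union_left,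
    Finset.union_assoc]
  tauto

theorem mem_link_singleton (hx : {x} ∈ Δ.faces) :
    G ∈ (Δ.link {x} hx).faces ↔ x ∉ G ∧ insert x G ∈ Δ.faces := by
  rw [mem_link, Finset.disjoint_singleton_left, Finset.insert_eq]

theorem isFacet_link_singleton (hx : {x} ∈ Δ.faces) :
    (Δ.link {x} hx).IsFacet G ↔ x ∉ G ∧ Δ.IsFacet (insert x G) := by
  rw [isFacet_link, Finset.disjoint_singleton_left, Finset.insert_eq]

end Faces

section Shellings

variable {V ι κ : Type*} [DecidableEq V] {Δ : FinSimplicialComplex V} {x : V}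

/-- A shelling order, as a family of finite sets over an arbitrary order instead of the initial
segments `Fin t` of `IsShellable`, so that shellings can be restricted and concatenated without
renumbering. -/
def IsShelling [LT ι] (F : ι → Finset V) : Prop :=
  ∀ ⦃i j⦄, j < i → ∃ x ∈ F i \ F j, ∃ k < i, F i \ F k = {x}

theorem IsShelling.isShellable [LinearOrder ι] [Finite ι] {F : ι → Finset V} (hF : IsShelling F)
    (hpure : Δ.IsPure) (hinj : Function.Injective F) (hfacet : ∀ G, Δ.IsFacet G ↔ ∃ i, F i = G) :
    Δ.IsShellable := by
  have := Fintype.ofFinite ι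
  let e := Fintype.orderIsoFinOfCardEq ι rfl
  refine ⟨hpure, _, F ∘ e, hinj.comp e.injective, fun G => ?_, fun i j hij => ?_⟩
  · rw [hfacet, e.surjective.exists, Function.comp_def]
  · obtain ⟨x, hx, k, hk, hik⟩ := hF (e.lt_iff_lt.2 hij)
    exact ⟨x, hx, e.symm k, e.symm_apply_lt.2 hk, by simpa using hik⟩

theorem IsShelling.insert_vertex [LT ι] {F : ι → Finset V} (hF : IsShelling F) (hx : ∀ i, x ∉ F i) :
    IsShelling fun i => insert x (F i) := by
  have hsdiff (i j) : insert x (F i) \ insert x (F j) = F i \ F j := by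
    rw [Finset.insert_sdiff_insert, Finset.sdiff_insert_of_notMem (hx i)]
  simpa only [IsShelling, hsdiff] using hF

theorem IsShelling.sumLex [LT ι] [LT κ] {F : ι → Finset V} {F' : κ → Finset V}
    (hF : IsShelling F) (hF' : IsShelling F')
    (h : ∀ i j, ∃ x ∈ F' i \ F j, ∃ k, F' i \ F k = {x}) :
    IsShelling fun i : ι ⊕ₗ κ => Sum.elim F F' (ofLex i) := by
  rintro (i | i) (j | j) hij
  · obtain ⟨x, hx, k, hk, hik⟩ := hF (Sum.Lex.inl_lt_inl_iff.1 hij)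
    exact ⟨x, hx, .inl k, Sum.Lex.inl_lt_inl_iff.2 hk, hik⟩
  · exact absurd hij Sum.Lex.not_inr_lt_inl
  · obtain ⟨x, hx, k, hik⟩ := h i j
    exact ⟨x, hx, .inl k, Sum.Lex.inl_lt_inr k i, hik⟩
  · obtain ⟨x, hx, k, hk, hik⟩ := hF' (Sum.Lex.inr_lt_inr_iff.1 hij)
    exact ⟨x, hx, .inr k, Sum.Lex.inr_lt_inr_iff.2 hk, hik⟩

theorem subset_of_sdiff_eq_singleton {A E F : Finset V} (h : E \ F = {x}) (hA : A ⊆ E)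
    (hx : x ∉ A) : A ⊆ F := by
  have hEF : E ⊆ F ∪ {x} := sdiff_le_iff.1 h.le
  exact (Finset.disjoint_singleton_right.2 hx).left_le_of_le_sup_right (hA.trans hEF)

theorem IsShelling.sdiff [LT ι] {F : ι → Finset V} (hF : IsShelling F) (A : Finset V) :
    IsShelling fun i : {i // A ⊆ F i} => F i \ A := by
  rintro ⟨i, hi⟩ ⟨j, hj⟩ hij
  obtain ⟨x, hx, k, hk, hik⟩ := hF hij
  rw [Finset.mem_sdiff] at hx
  have hxA : x ∉ A := fun h => hx.2 (hj h)
  refine ⟨x, by simp [hx, hxA], ⟨k, subset_of_sdiff_eq_singleton hik hi hxA⟩, hk, ?_⟩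
  change (F i \ A) \ (F k \ A) = {x}
  rw [sdiff_sdiff_sdiff_cancel_right (subset_of_sdiff_eq_singleton hik hi hxA), hik]

theorem IsSimplex.isShellable (h : Δ.IsSimplex) : Δ.IsShellable := by
  obtain ⟨F, hF⟩ := h
  have hfacet (G) : Δ.IsFacet G ↔ F = G := isFacet_iff_eq_of_faces_eq_powerset hF
  refine IsShelling.isShellable (F := fun _ : Unit => F) (fun _ _ h => absurd h (lt_irrefl _))
    (fun G H hG hH => ?_) (Function.injective_of_subsingleton _) fun G => by simp [hfacet]
  rw [← (hfacet G).1 hG, ← (hfacet H).1 hH]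

theorem isFacet_and_mem_iff_of_link {F : ι → Finset V} (hx : {x} ∈ Δ.faces)
    (hF : ∀ G, (Δ.link {x} hx).IsFacet G ↔ ∃ i, F i = G) (G : Finset V) :
    Δ.IsFacet G ∧ x ∈ G ↔ ∃ i, insert x (F i) = G := by
  constructor
  · rintro ⟨hG, hxG⟩
    obtain ⟨i, hi⟩ := (hF (G.erase x)).1
      ((isFacet_link_singleton hx).2 ⟨Finset.notMem_erase x G, by rwa [Finset.insert_erase hxG]⟩)
    exact ⟨i, by rw [hi, Finset.insert_erase hxG]⟩
  · rintro ⟨i, rfl⟩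
    exact ⟨((isFacet_link_singleton hx).1 ((hF _).2 ⟨i, rfl⟩)).2, Finset.mem_insert_self _ _⟩

theorem IsPure.isFacet_deletion_iff (h : Δ.IsPure) (hdel : (Δ.deletion x).IsPure)
    (hx : ∃ G, Δ.IsFacet G ∧ x ∉ G) (G : Finset V) :
    (Δ.deletion x).IsFacet G ↔ Δ.IsFacet G ∧ x ∉ G := by
  refine ⟨fun hG => ?_, fun hG => hG.1.deletion hG.2⟩
  obtain ⟨G₀, hG₀, hxG₀⟩ := hx
  obtain ⟨hGface, hxG⟩ := mem_deletion.1 hG.prop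
  obtain ⟨H, hH, hGH⟩ := exists_isFacet_superset hGface
  have hcard : G.card = H.card := (hdel hG (hG₀.deletion hxG₀)).trans (h hG₀ hH)
  rw [Finset.eq_of_subset_of_card_le hGH hcard.ge] at hxG ⊢
  exact ⟨hH, hxG⟩

/-- The facets avoiding `x` come first; every facet through `x` then meets them in its face
opposite `x`. -/
theorem IsShellable.of_link_of_deletion (hpure : Δ.IsPure) (hx : {x} ∈ Δ.faces)
    (hlink : (Δ.link {x} hx).IsShellable) (hdel : (Δ.deletion x).IsShellable) :
    Δ.IsShellable := by
  obtain ⟨-, t, F, hinj, hfacet, hF⟩ := hlink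
  obtain ⟨hpure', t', F', hinj', hfacet', hF'⟩ := hdel
  have hxF (i) : x ∉ F i := ((isFacet_link_singleton hx).1 ((hfacet _).2 ⟨i, rfl⟩)).1
  have hthrough := isFacet_and_mem_iff_of_link hx hfacet
  have hshell : IsShelling fun i => insert x (F i) :=
    IsShelling.insert_vertex (fun i j => hF i j) hxF
  have hinj_insert : Function.Injective fun i => insert x (F i) := fun i j hij => hinj <| by
    simpa only [Finset.erase_insert (hxF _)] using congrArg (Finset.erase · x) hij
  by_cases hcone : ∀ G, Δ.IsFacet G → x ∈ G
  · refine hshell.isShellable hpure hinj_insert fun G => ?_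
    rw [← hthrough, iff_self_and]
    exact hcone G
  push Not at hcone
  have havoid (G) : Δ.IsFacet G ∧ x ∉ G ↔ ∃ i, F' i = G :=
    (hpure.isFacet_deletion_iff hpure' hcone G).symm.trans (hfacet' G)
  have hxF' (i) : x ∉ F' i := ((havoid _).2 ⟨i, rfl⟩).2
  have hmeet (i j) : ∃ y ∈ insert x (F i) \ F' j, ∃ k, insert x (F i) \ F' k = {y} := by
    refine ⟨x, by simp [hxF'], ?_⟩
    have hface : F i ∈ (Δ.deletion x).faces := mem_deletion.2
      ⟨Δ.down_closed ((hthrough _).2 ⟨i, rfl⟩).1.prop (Finset.subset_insert _ _), hxF i⟩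
    obtain ⟨H, hH, hFH⟩ := exists_isFacet_superset hface
    obtain ⟨k, rfl⟩ := (hfacet' H).1 hH
    refine ⟨k, ?_⟩
    rw [Finset.insert_sdiff_of_notMem _ (hxF' k), Finset.sdiff_eq_empty_iff_subset.2 hFH,
      insert_empty_eq]
  refine (IsShelling.sumLex (fun i j => hF' i j) hshell hmeet).isShellable hpure
    (Function.Injective.sumElim hinj' hinj_insert fun i j hij => ?_) fun G => ?_
  · exact hxF' i (hij ▸ Finset.mem_insert_self x (F j))
  · rw [toLex.surjective.exists, Sum.exists]
    simp only [ofLex_toLex, Sum.elim_inl, Sum.elim_inr, ← havoid, ← hthrough]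
    tauto

theorem IsVertexDecomposable.isShellable (h : Δ.IsVertexDecomposable) : Δ.IsShellable := by
  induction h with
  | simplex Δ h => exact h.isShellable
  | shed Δ hpure x hx _ _ hlink hdel => exact .of_link_of_deletion hpure hx hlink hdel

end Shellings

section Chains

variable {K : Type*} [Field K] {V : Type*} {P : Set (Finset V)} {m : ℕ}

variable (K P m) in
/-- The chains on the members of `P` with `m` elements. In contrast to `chains`, the grading is by
cardinality and `P` is an arbitrary family, possibly empty. -/
def cardChains : Submodule K (Finset V →₀ K) :=
  Finsupp.supported K K {G | G ∈ P ∧ G.card = m}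

theorem cardChains_union (Q : Set (Finset V)) :
    cardChains K (P ∪ Q) m = cardChains K P m ⊔ cardChains K Q m := by
  rw [cardChains, cardChains, cardChains, ← Finsupp.supported_union]
  congr 1
  ext G
  exact or_and_right

theorem cardChains_mono {Q : Set (Finset V)} (h : P ⊆ Q) : cardChains K P m ≤ cardChains K Q m :=
  Finsupp.supported_mono fun _ hG => ⟨h hG.1, hG.2⟩

theorem chains_natCast_sub_one (Δ : FinSimplicialComplex V) (m : ℕ) :
    chains K Δ ((m : ℤ) - 1) = cardChains K (Δ.faces : Set (Finset V)) m := by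
  simp [chains, cardChains]

end Chains

section Homology

variable {K : Type*} [Field K] {V : Type*} [LinearOrder V]
variable {Δ : FinSimplicialComplex V} {P S T : Set (Finset V)} {c : Finset V →₀ K} {m : ℕ} {w : V}

variable (K) in
/-- The cone operator with apex `w`, which joins `w` to the sets that do not contain it and is
therefore a contracting homotopy of the full simplex. -/
noncomputable def coneMap (w : V) : (Finset V →₀ K) →ₗ[K] (Finset V →₀ K) :=
  Finsupp.linearCombination K fun F =>
    if w ∈ F then 0 else Finsupp.single (insert w F) ((-1 : K) ^ (F.filter (· < w)).card)

theorem coneMap_single_of_mem {F : Finset V} (hw : w ∈ F) (a : K) :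
    coneMap K w (Finsupp.single F a) = 0 := by
  simp [coneMap, hw]

theorem coneMap_single_of_notMem {F : Finset V} (hw : w ∉ F) (a : K) :
    coneMap K w (Finsupp.single F a) =
      Finsupp.single (insert w F) (a * (-1) ^ (F.filter (· < w)).card) := by
  simp [coneMap, hw]

theorem boundary_single_coeff (F : Finset V) (a : K) :
    boundary K (Finsupp.single F a) =
      ∑ x ∈ F, Finsupp.single (F.erase x) (a * (-1) ^ (F.filter (· < x)).card) := by
  simp [boundary, Finset.smul_sum]

theorem sign_insert_add_sign_erase {F : Finset V} {x : V} (hw : w ∉ F) (hx : x ∈ F) :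
    (-1 : K) ^ (F.filter (· < w)).card * (-1) ^ ((insert w F).filter (· < x)).card +
      (-1) ^ (F.filter (· < x)).card * (-1) ^ ((F.erase x).filter (· < w)).card = 0 := by
  rcases lt_or_gt_of_ne (ne_of_mem_of_not_mem hx hw) with h | h
  · have hinsert : (insert w F).filter (· < x) = F.filter (· < x) := by
      rw [Finset.filter_insert, if_neg h.not_gt]
    have herase : (F.filter (· < w)).card = ((F.erase x).filter (· < w)).card + 1 := by
      rw [Finset.filter_erase, Finset.card_erase_add_one (Finset.mem_filter.2 ⟨hx, h⟩)]
    rw [hinsert, herase, pow_succ]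
    ring
  · have hinsert : ((insert w F).filter (· < x)).card = (F.filter (· < x)).card + 1 := by
      rw [Finset.filter_insert, if_pos h, Finset.card_insert_of_notMem (by simp [hw])]
    have herase : (F.erase x).filter (· < w) = F.filter (· < w) := by
      rw [Finset.filter_erase, Finset.erase_eq_of_notMem (by simp [h.le])]
    rw [hinsert, herase, pow_succ]
    ring

theorem boundary_coneMap_add_coneMap_boundary (w : V) (c : Finset V →₀ K) :
    boundary K (coneMap K w c) + coneMap K w (boundary K c) = c := by
  suffices h : boundary K ∘ₗ coneMap K w + coneMap K w ∘ₗ boundary K = LinearMap.id from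
    LinearMap.congr_fun h c
  refine Finsupp.lhom_ext' fun F => LinearMap.ext_ring ?_
  simp only [LinearMap.comp_apply, Finsupp.lsingle_apply, LinearMap.add_apply, LinearMap.id_apply]
  rw [boundary_single, map_sum]
  by_cases hw : w ∈ F
  · rw [coneMap_single_of_mem hw, map_zero, zero_add, Finset.sum_eq_single_of_mem w hw]
    · rw [coneMap_single_of_notMem (Finset.notMem_erase w F), Finset.insert_erase hw,
        Finset.filter_erase, Finset.erase_eq_of_notMem (by simp), ← mul_pow]
      simp
    · exact fun x _ hxw => coneMap_single_of_mem (Finset.mem_erase.2 ⟨hxw.symm, hw⟩) _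
  · rw [coneMap_single_of_notMem hw, boundary_single_coeff, Finset.sum_insert hw,
      Finset.erase_insert hw, add_assoc, ← Finset.sum_add_distrib, Finset.sum_eq_zero, add_zero]
    · rw [Finset.filter_insert, if_neg (lt_irrefl w), one_mul, ← mul_pow]
      simp
    · intro x hx
      rw [coneMap_single_of_notMem (fun h => hw (Finset.mem_of_mem_erase h)),
        Finset.erase_insert_of_ne (ne_of_mem_of_not_mem hx hw).symm, ← Finsupp.single_add, one_mul,
        sign_insert_add_sign_erase hw hx, Finsupp.single_zero]

theorem coneMap_mem_supported (hc : c ∈ Finsupp.supported K K S)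
    (h : ∀ F ∈ S, w ∉ F → insert w F ∈ T) : coneMap K w c ∈ Finsupp.supported K K T := by
  rw [coneMap, Finsupp.linearCombination_apply]
  refine Submodule.sum_mem _ fun F hF => Submodule.smul_mem _ _ ?_
  split_ifs with hw
  · exact Submodule.zero_mem _
  · exact Finsupp.single_mem_supported K _ (h F (hc hF) hw)

theorem boundary_mem_supported (hc : c ∈ Finsupp.supported K K S)
    (h : ∀ F ∈ S, ∀ x ∈ F, F.erase x ∈ T) : boundary K c ∈ Finsupp.supported K K T := by
  rw [boundary, Finsupp.linearCombination_apply]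
  refine Submodule.sum_mem _ fun F hF => Submodule.smul_mem _ _ (Submodule.sum_mem _ fun x hx => ?_)
  exact Finsupp.single_mem_supported K _ (h F (hc hF) x hx)

theorem boundary_mem_supported_of_isLowerSet (hP : IsLowerSet P) (hc : c ∈ cardChains K P m) :
    boundary K c ∈ Finsupp.supported K K {G | G ∈ P ∧ G.card + 1 = m} :=
  boundary_mem_supported hc fun F hF x hx =>
    ⟨hP (Finset.erase_subset x F) hF.1, (Finset.card_erase_add_one hx).trans hF.2⟩

theorem coneMap_mem_cardChains_Iic {E : Finset V} (hw : w ∈ E)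
    (hc : c ∈ cardChains K (Set.Iic E) m) : coneMap K w c ∈ cardChains K (Set.Iic E) (m + 1) :=
  coneMap_mem_supported hc fun _ hF hwF =>
    ⟨Finset.insert_subset hw hF.1, by rw [Finset.card_insert_of_notMem hwF, hF.2]⟩

variable (K P m) in
/-- Every cycle on `m`-element members of `P` is a boundary in `P`; for the faces of a complex this
is the vanishing of the reduced homology in degree `m - 1`. -/
def IsAcyclicAt : Prop :=
  cardChains K P m ⊓ LinearMap.ker (boundary K) ≤ (cardChains K P (m + 1)).map (boundary K)

/-- The new simplex meets the old complex in a cone with apex `w`. -/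
theorem IsAcyclicAt.union_Iic {E : Finset V} (hacyclic : IsAcyclicAt K P m) (hP : IsLowerSet P)
    (hw : w ∈ E) (hcone : ∀ G ⊆ E, G ∈ P → insert w G ∈ P) :
    IsAcyclicAt K (P ∪ Set.Iic E) m := by
  rintro c ⟨hc, hbc⟩
  rw [SetLike.mem_coe, cardChains_union] at hc
  obtain ⟨c₀, hc₀, c₁, hc₁, rfl⟩ := Submodule.mem_sup.1 hc
  have hboundary : boundary K c₁ = -boundary K c₀ := by
    rwa [SetLike.mem_coe, LinearMap.mem_ker, map_add, add_comm, ← eq_neg_iff_add_eq_zero] at hbc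
  have hmeet : boundary K c₁ ∈ Finsupp.supported K K
      ({G | G ∈ P ∧ G.card + 1 = m} ∩ {G | G ∈ Set.Iic E ∧ G.card + 1 = m}) := by
    rw [Finsupp.supported_inter]
    refine ⟨?_, boundary_mem_supported_of_isLowerSet (isLowerSet_Iic E) hc₁⟩
    rw [hboundary]
    exact Submodule.neg_mem _ (boundary_mem_supported_of_isLowerSet hP hc₀)
  have hold : coneMap K w (boundary K c₁) ∈ cardChains K P m :=
    coneMap_mem_supported hmeet fun F hF hwF =>
      ⟨hcone F hF.2.1 hF.1.1, (Finset.card_insert_of_notMem hwF).trans hF.1.2⟩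
  have hhomotopy := boundary_coneMap_add_coneMap_boundary w c₁
  have hcycle : boundary K (c₀ + coneMap K w (boundary K c₁)) = 0 := by
    have h := congrArg (boundary K) hhomotopy
    rw [map_add, boundary_boundary, zero_add] at h
    rw [map_add, h, hboundary, add_neg_cancel]
  obtain ⟨b, hb, hbc₀⟩ := hacyclic ⟨Submodule.add_mem _ hc₀ hold, hcycle⟩
  refine ⟨b + coneMap K w c₁, ?_, ?_⟩
  · rw [SetLike.mem_coe, cardChains_union]
    exact Submodule.add_mem_sup hb (coneMap_mem_cardChains_Iic hw hc₁)
  · rw [map_add, hbc₀, add_assoc, add_comm (coneMap K w _), hhomotopy]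

theorem IsAcyclicAt.union_of_forall_mem {Q : Set (Finset V)} (hacyclic : IsAcyclicAt K P m)
    (h : ∀ G ∈ Q, G.card = m → G ∈ P) : IsAcyclicAt K (P ∪ Q) m := by
  have hle : cardChains K (P ∪ Q) m ≤ cardChains K P m :=
    Finsupp.supported_mono fun G hG => ⟨hG.1.elim id (h G · hG.2), hG.2⟩
  exact (inf_le_inf_right _ hle).trans
    (hacyclic.trans (Submodule.map_mono (cardChains_mono Set.subset_union_left)))

theorem isAcyclicAt_empty : IsAcyclicAt K (∅ : Set (Finset V)) m := by
  simp [IsAcyclicAt, cardChains]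

theorem IsShelling.isAcyclicAt {ι : Type*} [LinearOrder ι] [Finite ι] {F : ι → Finset V}
    (hF : IsShelling F) (hcard : ∀ i, m < (F i).card) :
    IsAcyclicAt K (⋃ i, Set.Iic (F i)) m := by
  suffices h : ∀ s : Finset ι, IsLowerSet (s : Set ι) →
      IsAcyclicAt K (⋃ i ∈ s, Set.Iic (F i)) m by
    have := Fintype.ofFinite ι
    simpa using h Finset.univ (by simpa using isLowerSet_univ)
  intro s hs
  induction s using Finset.induction_on_max with
  | empty => simpa using isAcyclicAt_empty
  | insert i s hlt ih =>
    have hmem : ∀ k < i, k ∈ s := fun k hk =>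
      Finset.mem_of_mem_insert_of_ne (hs hk.le (Finset.mem_insert_self i s)) hk.ne
    have hacyclic := ih fun j k hkj hj => hmem k (hkj.trans_lt (hlt j hj))
    have old {k G} (hk : k < i) (hG : G ⊆ F k) : G ∈ ⋃ j ∈ s, Set.Iic (F j) :=
      Set.mem_biUnion (hmem k hk) hG
    rw [Finset.set_biUnion_insert, Set.union_comm]
    by_cases hfree : ∃ w ∈ F i, ∀ k < i, F i \ F k ≠ {w}
    · obtain ⟨w, hw, hne⟩ := hfree
      have hlower := isLowerSet_iUnion₂ fun j (_ : j ∈ s) => isLowerSet_Iic (F j)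
      refine hacyclic.union_Iic hlower hw fun G hG hGP => ?_
      obtain ⟨j, hj, hGj⟩ := Set.mem_iUnion₂.1 hGP
      obtain ⟨x, hx, k, hk, hik⟩ := hF (hlt j hj)
      have hxw : x ≠ w := by rintro rfl; exact hne k hk hik
      have hxG : x ∉ G := fun h => (Finset.mem_sdiff.1 hx).2 (hGj h)
      exact old hk (subset_of_sdiff_eq_singleton hik (Finset.insert_subset hw hG)
        (by simp [hxw, hxG]))
    · push Not at hfree
      refine hacyclic.union_of_forall_mem fun G hG hGm => ?_
      obtain ⟨x, hx, hxG⟩ := Finset.exists_mem_notMem_of_card_lt_card (hGm.trans_lt (hcard i))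
      obtain ⟨k, hk, hik⟩ := hfree x hx
      exact old hk (subset_of_sdiff_eq_singleton hik hG hxG)

theorem subsingleton_reducedHomology_iff_le {i : ℤ} :
    Subsingleton (ReducedHomology K Δ i) ↔ cycles K Δ i ≤ boundaries K Δ i :=
  Submodule.Quotient.subsingleton_iff.trans Submodule.submoduleOf_eq_top

theorem subsingleton_reducedHomology_iff_isAcyclicAt :
    Subsingleton (ReducedHomology K Δ ((m : ℤ) - 1)) ↔
      IsAcyclicAt K (Δ.faces : Set (Finset V)) m := by
  have hsucc : (m : ℤ) - 1 + 1 = ((m + 1 : ℕ) : ℤ) - 1 := by push_cast; ring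
  rw [subsingleton_reducedHomology_iff_le, cycles, boundaries, IsAcyclicAt, hsucc,
    chains_natCast_sub_one, chains_natCast_sub_one]

theorem subsingleton_reducedHomology_of_lt_neg_one {i : ℤ} (hi : i < -1) :
    Subsingleton (ReducedHomology K Δ i) := by
  have hempty : {F | F ∈ Δ.faces ∧ (F.card : ℤ) - 1 = i} = ∅ :=
    Set.eq_empty_of_forall_notMem fun F hF => by have := hF.2; omega
  rw [subsingleton_reducedHomology_iff_le, cycles, chains, hempty, Finsupp.supported_empty,
    bot_inf_eq]
  exact bot_le

theorem IsShellable.subsingleton_reducedHomology (h : Δ.IsShellable) {i : ℤ} (hi : i < Δ.dim) :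
    Subsingleton (ReducedHomology K Δ i) := by
  rcases lt_or_ge i (-1) with hi' | hi'
  · exact subsingleton_reducedHomology_of_lt_neg_one hi'
  obtain ⟨m, rfl⟩ : ∃ m : ℕ, i = m - 1 := ⟨(i + 1).toNat, by omega⟩
  obtain ⟨hpure, t, F, -, hF, hshell⟩ := h
  have hfacet (j) : Δ.IsFacet (F j) := (hF _).2 ⟨j, rfl⟩
  have hfaces : (Δ.faces : Set (Finset V)) = ⋃ j, Set.Iic (F j) := by
    ext G
    rw [Set.mem_iUnion]
    constructor
    · intro hG
      obtain ⟨H, hH, hGH⟩ := exists_isFacet_superset hG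
      obtain ⟨j, rfl⟩ := (hF H).1 hH
      exact ⟨j, hGH⟩
    · rintro ⟨j, hj⟩
      exact Δ.down_closed (hfacet j).prop hj
  rw [subsingleton_reducedHomology_iff_isAcyclicAt, hfaces]
  refine IsShelling.isAcyclicAt (fun i j => hshell i j) fun j => ?_
  rw [hpure.dim_eq (hfacet j)] at hi
  omega

theorem IsShellable.link (h : Δ.IsShellable) {A : Finset V} (hA : A ∈ Δ.faces) :
    (Δ.link A hA).IsShellable := by
  obtain ⟨hpure, t, F, hinj, hF, hshell⟩ := h
  refine (IsShelling.sdiff (fun i j => hshell i j) A).isShellable (hpure.link hA) ?_ fun G => ?_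
  · rintro ⟨i, hi⟩ ⟨j, hj⟩ hij
    refine Subtype.ext (hinj ?_)
    rw [← Finset.sdiff_union_of_subset hi, ← Finset.sdiff_union_of_subset hj]
    exact congrArg (· ∪ A) hij
  · rw [isFacet_link hA, hF]
    constructor
    · rintro ⟨hdisj, i, hi⟩
      exact ⟨⟨i, hi ▸ Finset.subset_union_left⟩, by
        rw [hi, Finset.union_sdiff_cancel_left hdisj]⟩
    · rintro ⟨⟨i, hi⟩, rfl⟩
      exact ⟨Finset.disjoint_sdiff, i, (Finset.union_sdiff_of_subset hi).symm⟩

theorem IsShellable.isCohenMacaulay (h : Δ.IsShellable) : Δ.IsCohenMacaulay K :=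
  ⟨h.1, fun _ hF _ hi => (h.link hF).subsingleton_reducedHomology hi⟩

theorem IsCohenMacaulay.link (h : Δ.IsCohenMacaulay K) {F : Finset V} (hF : F ∈ Δ.faces) :
    (Δ.link F hF).IsCohenMacaulay K := by
  refine ⟨h.1.link hF, fun G hG i hi => ?_⟩
  rw [link_link hF hG] at hi ⊢
  exact h.2 _ _ i hi

theorem IsCohenMacaulay.isBuchsbaum (h : Δ.IsCohenMacaulay K) : Δ.IsBuchsbaum K :=
  ⟨h.1, fun _ hx => h.link hx⟩

theorem IsCohenMacaulay.subsingleton_reducedHomology (h : Δ.IsCohenMacaulay K) {i : ℤ}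
    (hi : i < Δ.dim) : Subsingleton (ReducedHomology K Δ i) := by
  have hlink := h.2 ∅ Δ.empty_mem i
  rw [link_empty] at hlink
  exact hlink hi

end Homology

section VertexDecomposableFamilies

variable {V : Type*} [DecidableEq V] {Δ : FinSimplicialComplex V}

theorem card_eq_of_sliding {F : ℕ → Finset V} {y z : ℕ → V} {m : ℕ}
    (hslide : ∀ i < m, F (i + 1) = insert (y i) ((F i).erase (z i)))
    (hz : ∀ i < m, z i ∈ F i) (hy : ∀ i < m, y i ∉ F i) {i : ℕ} (hi : i ≤ m) :
    (F i).card = (F 0).card := by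
  induction i with
  | zero => rfl
  | succ i ih =>
    rw [hslide i hi, Finset.card_insert_of_notMem fun h => hy i hi (Finset.mem_of_mem_erase h),
      Finset.card_erase_add_one (hz i hi), ih (Nat.le_of_succ_le hi)]

/-- The element `y (m - 1)` entering last is a shedding vertex: it lies in `F m` only, and deleting
it leaves a subset of `F (m - 1)`. -/
theorem isVertexDecomposable_of_sliding {F : ℕ → Finset V} {y z : ℕ → V} {m : ℕ}
    (hslide : ∀ i < m, F (i + 1) = insert (y i) ((F i).erase (z i)))
    (hz : ∀ i < m, z i ∈ F i) (hy : ∀ i < m, ∀ j ≤ i, y i ∉ F j)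
    (hΔ : ∀ W, W ∈ Δ.faces ↔ ∃ i ≤ m, W ⊆ F i) : Δ.IsVertexDecomposable := by
  induction m generalizing Δ with
  | zero => exact .simplex Δ ⟨F 0, by ext W; simp [hΔ]⟩
  | succ m ih =>
    have hpure : Δ.IsPure := by
      refine isPure_of_forall_exists_superset_card_eq (m := (F 0).card) fun G hG => ?_
      obtain ⟨i, hi, hGi⟩ := (hΔ G).1 hG
      exact ⟨F i, (hΔ _).2 ⟨i, hi, subset_rfl⟩, hGi,
        card_eq_of_sliding hslide hz (fun i hi => hy i hi i le_rfl) hi⟩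
    have hlast := hslide m m.lt_succ_self
    have hnew := hy m m.lt_succ_self
    have hface : {y m} ∈ Δ.faces := (hΔ _).2 ⟨m + 1, le_rfl, by simp [hlast]⟩
    refine .shed Δ hpure (y m) hface (.simplex _ ⟨(F (m + 1)).erase (y m), ?_⟩)
      (ih (fun i hi => hslide i (hi.trans m.lt_succ_self))
        (fun i hi => hz i (hi.trans m.lt_succ_self))
        (fun i hi => hy i (hi.trans m.lt_succ_self)) fun W => ?_)
    · ext W
      rw [mem_link_singleton, hΔ, Finset.mem_powerset, Finset.subset_erase, and_comm]
      refine and_congr_left fun _ => ⟨?_, fun hW => ⟨m + 1, le_rfl, ?_⟩⟩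
      · rintro ⟨i, hi, hW⟩
        obtain ⟨hyi, hWi⟩ := Finset.insert_subset_iff.1 hW
        obtain rfl : i = m + 1 := by
          by_contra hne
          exact hnew i (by omega) hyi
        exact hWi
      · exact Finset.insert_subset (by simp [hlast]) hW
    · rw [mem_deletion, hΔ]
      constructor
      · rintro ⟨⟨i, hi, hW⟩, hyW⟩
        rcases Nat.le_succ_iff.1 hi with hi | rfl
        · exact ⟨i, hi, hW⟩
        · rw [hlast, Finset.subset_insert_iff_of_notMem hyW] at hW
          exact ⟨m, le_rfl, hW.trans (Finset.erase_subset _ _)⟩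
      · rintro ⟨i, hi, hW⟩
        exact ⟨⟨i, hi.trans m.le_succ, hW⟩, fun h => hnew i hi (hW h)⟩

/-- The complex of all subsets of `U` that contain no pair `{x, σ x}`. For a fixed-point-free
involution `σ` this is the boundary of a cross-polytope (joined with a simplex when `U` is not
`σ`-invariant). -/
def antipodeFree (σ : V → V) (U : Finset V) : FinSimplicialComplex V where
  faces := U.powerset.filter fun W => ∀ x ∈ W, σ x ∉ W
  empty_mem := by simp
  down_closed F G hF hGF := by
    rw [Finset.mem_filter, Finset.mem_powerset] at hF ⊢
    exact ⟨hGF.trans hF.1, fun x hx hσx => hF.2 x (hGF hx) (hGF hσx)⟩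

variable {σ : V → V} {U W : Finset V} {x : V}

theorem mem_antipodeFree : W ∈ (antipodeFree σ U).faces ↔ W ⊆ U ∧ ∀ x ∈ W, σ x ∉ W := by
  rw [antipodeFree, Finset.mem_filter, Finset.mem_powerset]

theorem deletion_antipodeFree : (antipodeFree σ U).deletion x = antipodeFree σ (U.erase x) := by
  ext W
  rw [mem_deletion, mem_antipodeFree, mem_antipodeFree, Finset.subset_erase]
  tauto

theorem insert_mem_antipodeFree_iff (hσ : Function.Involutive σ) (hfix : ∀ x, σ x ≠ x)
    (hx : x ∈ U) : insert x W ∈ (antipodeFree σ U).faces ↔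
      W ∈ (antipodeFree σ U).faces ∧ σ x ∉ W := by
  have hantipode : ∀ y, σ y = x ↔ y = σ x := fun y => hσ.eq_iff
  simp only [mem_antipodeFree, Finset.insert_subset_iff, Finset.mem_insert, not_or,
    hantipode]
  grind

theorem link_antipodeFree (hσ : Function.Involutive σ) (hfix : ∀ x, σ x ≠ x)
    (hx : {x} ∈ (antipodeFree σ U).faces) :
    (antipodeFree σ U).link {x} hx = antipodeFree σ ((U.erase x).erase (σ x)) := by
  have hxU : x ∈ U := Finset.singleton_subset_iff.1 (mem_antipodeFree.1 hx).1
  ext W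
  rw [mem_link_singleton, insert_mem_antipodeFree_iff hσ hfix hxU, mem_antipodeFree,
    mem_antipodeFree, Finset.subset_erase, Finset.subset_erase]
  tauto

theorem union_image_eq_of_isFacet_antipodeFree (hσ : Function.Involutive σ) (hfix : ∀ x, σ x ≠ x)
    (hW : (antipodeFree σ U).IsFacet W) : W ∪ W.image σ = U ∪ U.image σ := by
  have hWU := (mem_antipodeFree.1 hW.prop).1
  have hcover : ∀ x ∈ U, x ∈ W ∨ σ x ∈ W := by
    intro x hx
    by_contra! h
    exact h.1 (hW.2 ((insert_mem_antipodeFree_iff hσ hfix hx).2 ⟨hW.prop, h.2⟩)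
      (Finset.subset_insert x W) (Finset.mem_insert_self x W))
  refine (Finset.union_subset_union hWU (Finset.image_subset_image hWU)).antisymm ?_
  refine Finset.union_subset (fun x hx => ?_) fun y hy => ?_
  · exact Finset.mem_union.2 ((hcover x hx).imp_right fun h => Finset.mem_image.2 ⟨σ x, h, hσ x⟩)
  · obtain ⟨x, hx, rfl⟩ := Finset.mem_image.1 hy
    exact Finset.mem_union.2 ((hcover x hx).symm.imp_right (Finset.mem_image_of_mem σ))

theorem isPure_antipodeFree (hσ : Function.Involutive σ) (hfix : ∀ x, σ x ≠ x) :
    (antipodeFree σ U).IsPure := by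
  have two_mul_card (W) (hW : (antipodeFree σ U).IsFacet W) :
      2 * W.card = (U ∪ U.image σ).card := by
    have hdisj : Disjoint W (W.image σ) := by
      rw [Finset.disjoint_right]
      exact Finset.forall_mem_image.2 (mem_antipodeFree.1 hW.prop).2
    rw [← union_image_eq_of_isFacet_antipodeFree hσ hfix hW, Finset.card_union_of_disjoint hdisj,
      Finset.card_image_of_injective _ hσ.injective, two_mul]
  intro F G hF hG
  have := two_mul_card F hF
  have := two_mul_card G hG
  omega

theorem isVertexDecomposable_antipodeFree (hσ : Function.Involutive σ) (hfix : ∀ x, σ x ≠ x)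
    (U : Finset V) : (antipodeFree σ U).IsVertexDecomposable := by
  induction U using Finset.strongInduction with
  | H U ih =>
    obtain rfl | ⟨x, hx⟩ := U.eq_empty_or_nonempty
    · refine .simplex _ ⟨∅, ?_⟩
      ext W
      simp +contextual [mem_antipodeFree, Finset.subset_empty]
    have hface : {x} ∈ (antipodeFree σ U).faces := by simp [mem_antipodeFree, hx, hfix]
    have hlt := Finset.erase_ssubset hx
    refine .shed _ (isPure_antipodeFree hσ hfix) x hface ?_ ?_
    · rw [link_antipodeFree hσ hfix]
      exact ih _ ((Finset.erase_subset _ _).trans_ssubset hlt)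
    · rw [deletion_antipodeFree]
      exact ih _ hlt

end VertexDecomposableFamilies

section WellCovered

variable {V : Type*} [Fintype V] {G : SimpleGraph V} {W : Finset V}

theorem mem_independenceComplex :
    W ∈ G.independenceComplex.faces ↔ G.IsIndepSet (W : Set V) := by
  simp [SimpleGraph.independenceComplex]

theorem minimal_isVertexCover_iff_isFacet_compl [DecidableEq V] :
    Minimal (fun C : Finset V => G.IsVertexCover (C : Set V)) W ↔
      G.independenceComplex.IsFacet Wᶜ := by
  have hcover (C : Finset V) : G.IsVertexCover (C : Set V) ↔ Cᶜ ∈ G.independenceComplex.faces := by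
    rw [mem_independenceComplex, Finset.coe_compl, SimpleGraph.isIndepSet_compl_iff_isVertexCover]
  simp only [IsFacet, Minimal, Maximal, hcover]
  refine and_congr_right fun _ => ⟨fun h H hH hWH => ?_, fun h C hC hCW => ?_⟩
  · rw [← compl_compl H] at hH
    exact le_compl_comm.1 (h hH (compl_le_iff_compl_le.1 hWH))
  · exact compl_le_compl_iff_le.1 (h hC (compl_le_compl_iff_le.2 hCW))

theorem isPure_independenceComplex_iff_isWellCovered :
    G.independenceComplex.IsPure ↔ G.IsWellCovered := by
  classical
  have hcard (C D : Finset V) : Cᶜ.card = Dᶜ.card ↔ C.card = D.card := by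
    have := C.card_le_univ
    have := D.card_le_univ
    rw [Finset.card_compl, Finset.card_compl]
    omega
  simp only [IsPure, SimpleGraph.IsWellCovered, minimal_isVertexCover_iff_isFacet_compl]
  rw [compl_surjective.forall]
  refine forall_congr' fun C => ?_
  rw [compl_surjective.forall]
  exact forall_congr' fun D => by rw [hcard]

end WellCovered

section Arcs

variable {n d : ℕ}

variable (n d) in
/-- The independence complex of `C_n(d + 1, …, ⌊n / 2⌋)`. -/
noncomputable abbrev arcComplex : FinSimplicialComplex (Fin n) :=
  (SimpleGraph.circulant n (Set.Icc (d + 1) (n / 2))).independenceComplex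

/-- The circular distance of `a` and `b` is at most `d`. -/
def IsClose (d : ℕ) (a b : Fin n) : Prop :=
  (b - a).val ≤ d ∨ (a - b).val ≤ d

/-- The arc `{s, s + 1, …, s + d}` modulo `n`. -/
def arc (d : ℕ) (s : Fin n) : Finset (Fin n) :=
  Finset.univ.filter fun x => (x - s).val ≤ d

theorem mem_arc {s x : Fin n} : x ∈ arc d s ↔ (x - s).val ≤ d := by
  simp [arc]

variable [NeZero n]

theorem val_sub_eq_ite (s a b : Fin n) :
    (a - b).val = if (b - s).val ≤ (a - s).val then (a - s).val - (b - s).val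
      else (a - s).val + n - (b - s).val := by
  rw [← sub_sub_sub_cancel_right a b s]
  split_ifs with h
  · exact Fin.sub_val_of_le h
  · rw [Fin.coe_sub_iff_lt.2 (not_le.1 h), add_comm]

theorem eq_add_ofNat_iff {k : ℕ} (hk : k < n) (s x : Fin n) :
    x = s + Fin.ofNat n k ↔ (x - s).val = k := by
  rw [← sub_eq_iff_eq_add', Fin.ext_iff, Fin.val_ofNat, Nat.mod_eq_of_lt hk]

theorem val_add_ofNat_sub {k : ℕ} (hk : k < n) (s : Fin n) :
    (s + Fin.ofNat n k - s).val = k :=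
  (eq_add_ofNat_iff hk s _).1 rfl

theorem val_sub_add_ofNat {k : ℕ} (hk : k < n) (s x : Fin n) :
    (x - (s + Fin.ofNat n k)).val =
      if k ≤ (x - s).val then (x - s).val - k else (x - s).val + n - k := by
  rw [val_sub_eq_ite s, val_add_ofNat_sub hk]

theorem add_ofNat_ne {k l : ℕ} (hk : k < n) (hl : l < n) (h : k ≠ l) (s : Fin n) :
    s + Fin.ofNat n k ≠ s + Fin.ofNat n l := by
  rwa [ne_eq, eq_add_ofNat_iff hl, val_add_ofNat_sub hk]

theorem isClose_iff_val_sub (s a b : Fin n) :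
    IsClose d a b ↔ ((a - s).val ≤ (b - s).val + d ∧ (b - s).val ≤ (a - s).val + d) ∨
      (a - s).val + n ≤ (b - s).val + d ∨ (b - s).val + n ≤ (a - s).val + d := by
  rw [IsClose, val_sub_eq_ite s, val_sub_eq_ite s a b]
  have := (a - s).isLt
  have := (b - s).isLt
  generalize (a - s).val = p at *
  generalize (b - s).val = q at *
  split_ifs <;> omega

theorem isClose_iff_val (a b : Fin n) :
    IsClose d a b ↔ (a.val ≤ b.val + d ∧ b.val ≤ a.val + d) ∨
      a.val + n ≤ b.val + d ∨ b.val + n ≤ a.val + d := by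
  simpa only [sub_zero] using isClose_iff_val_sub (d := d) 0 a b

theorem isClose_iff_not_adj_circulant (a b : Fin n) :
    IsClose d a b ↔ (a ≠ b → ¬ (SimpleGraph.circulant n (Set.Icc (d + 1) (n / 2))).Adj a b) := by
  simp only [SimpleGraph.circulant, isClose_iff_val, Set.mem_Icc, ne_eq, Fin.ext_iff]
  omega

theorem mem_arcComplex {W : Finset (Fin n)} :
    W ∈ (arcComplex n d).faces ↔ ∀ a ∈ W, ∀ b ∈ W, IsClose d a b := by
  rw [mem_independenceComplex, SimpleGraph.isIndepSet_iff, Set.Pairwise]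
  simp only [isClose_iff_not_adj_circulant, Finset.mem_coe]

theorem singleton_mem_arcComplex (v : Fin n) : {v} ∈ (arcComplex n d).faces := by
  simp [mem_arcComplex, isClose_iff_val]

theorem self_mem_arc (s : Fin n) : s ∈ arc d s := by
  simp [mem_arc]

theorem card_arc (h : d < n) (s : Fin n) : (arc d s).card = d + 1 := by
  have himage : (arc d s).map (Equiv.subRight s).toEmbedding =
      Finset.univ.filter fun x : Fin n => x.val < d + 1 := by
    ext x
    simp [arc, Finset.mem_map_equiv]
  rw [← Finset.card_map, himage, Fin.card_filter_val_lt]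
  omega

theorem arc_mem_arcComplex (s : Fin n) : arc d s ∈ (arcComplex n d).faces := by
  refine mem_arcComplex.2 fun a ha b hb => ?_
  rw [mem_arc] at ha hb
  rw [isClose_iff_val_sub s]
  omega

theorem isFacet_arc (h : 2 * d + 2 ≤ n) (s : Fin n) : (arcComplex n d).IsFacet (arc d s) := by
  refine ⟨arc_mem_arcComplex s, fun H hH hsub v hv => mem_arc.2 ?_⟩
  have hclose {k : ℕ} (hk : k ≤ d) : IsClose d v (s + Fin.ofNat n k) := by
    refine mem_arcComplex.1 hH v hv _ (hsub (mem_arc.2 ?_))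
    rwa [val_add_ofNat_sub (by omega)]
  by_contra! hlt
  have hstart := hclose (Nat.zero_le d)
  have hend := hclose le_rfl
  have hmid := @hclose ((v - s).val - (d + 1))
  rw [isClose_iff_val_sub s, val_add_ofNat_sub (by omega)] at hstart hend hmid
  omega

theorem exists_subset_arc (h : 3 * d < n) {W : Finset (Fin n)}
    (hW : W ∈ (arcComplex n d).faces) {v : Fin n} (hv : v ∈ W) : ∃ s, W ⊆ arc d s := by
  rw [mem_arcComplex] at hW
  obtain ⟨s, hs, hmax⟩ := Finset.exists_max_image (W.filter fun s => (v - s).val ≤ d)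
    (fun s => (v - s).val) ⟨v, by simp [hv]⟩
  rw [Finset.mem_filter] at hs
  refine ⟨s, fun w hw => mem_arc.2 ?_⟩
  have := hs.2
  have hvw := hW v hv w hw
  have hsw := hW s hs.1 w hw
  rw [isClose_iff_val_sub s] at hvw hsw
  rw [sub_self, Fin.val_zero] at hsw
  by_contra! hlt
  have hwv : (v - w).val = (v - s).val + n - (w - s).val := by
    rw [val_sub_eq_ite s v w, if_neg (by omega)]
  have := hmax w (Finset.mem_filter.2 ⟨hw, by omega⟩)
  omega

theorem mem_arcComplex_iff_exists_subset_arc (h : 3 * d < n) {W : Finset (Fin n)} :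
    W ∈ (arcComplex n d).faces ↔ ∃ s, W ⊆ arc d s := by
  refine ⟨fun hW => ?_, fun ⟨s, hs⟩ => (arcComplex n d).down_closed (arc_mem_arcComplex s) hs⟩
  obtain rfl | ⟨v, hv⟩ := W.eq_empty_or_nonempty
  · exact ⟨0, Finset.empty_subset _⟩
  · exact exists_subset_arc h hW hv

theorem isPure_arcComplex (h : 3 * d < n) : (arcComplex n d).IsPure := by
  refine isPure_of_forall_exists_superset_card_eq (m := d + 1) fun W hW => ?_
  obtain ⟨s, hs⟩ := (mem_arcComplex_iff_exists_subset_arc h).1 hW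
  exact ⟨arc d s, arc_mem_arcComplex s, hs, card_arc (by omega) s⟩

theorem arc_succ (t : Fin n) {i : ℕ} (hi : i + d + 1 < n) :
    arc d (t + Fin.ofNat n (i + 1)) =
      insert (t + Fin.ofNat n (i + d + 1))
        ((arc d (t + Fin.ofNat n i)).erase (t + Fin.ofNat n i)) := by
  ext x
  have := (x - t).isLt
  rw [Finset.mem_insert, Finset.mem_erase, mem_arc, mem_arc, ne_eq, eq_add_ofNat_iff hi,
    eq_add_ofNat_iff (by omega), val_sub_add_ofNat (by omega), val_sub_add_ofNat (by omega)]
  generalize (x - t).val = p at *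
  split_ifs <;> omega

theorem notMem_arc {i j : ℕ} (t : Fin n) (hi : i + d + 1 < n) (hj : j ≤ i) :
    t + Fin.ofNat n (i + d + 1) ∉ arc d (t + Fin.ofNat n j) := by
  rw [mem_arc, val_sub_add_ofNat (by omega), val_add_ofNat_sub hi]
  split_ifs <;> omega

theorem mem_arcComplex_iff_exists_le (h : 3 * d < n) {t : Fin n} {W : Finset (Fin n)}
    (hW : t + Fin.ofNat n d ∈ W) :
    W ∈ (arcComplex n d).faces ↔ ∃ i ≤ d, W ⊆ arc d (t + Fin.ofNat n i) := by
  rw [mem_arcComplex_iff_exists_subset_arc h]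
  refine ⟨fun ⟨s, hs⟩ => ?_, fun ⟨i, _, hi⟩ => ⟨_, hi⟩⟩
  have hst : s = t + Fin.ofNat n (s - t).val := (eq_add_ofNat_iff (s - t).isLt t s).2 rfl
  refine ⟨(s - t).val, ?_, hst ▸ hs⟩
  have hmem := mem_arc.1 (hs hW)
  rw [val_sub_eq_ite t, val_add_ofNat_sub (by omega)] at hmem
  split_ifs at hmem <;> omega

/-- The facets of the link are the arcs through `v` without `v`; they slide from the arc ending at
`v` to the arc starting at `v`. -/
theorem isVertexDecomposable_link_arcComplex (h : 3 * d < n) {v : Fin n}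
    (hv : {v} ∈ (arcComplex n d).faces) :
    ((arcComplex n d).link {v} hv).IsVertexDecomposable := by
  obtain ⟨t, rfl⟩ : ∃ t, v = t + Fin.ofNat n d := ⟨v - Fin.ofNat n d, by simp⟩
  refine isVertexDecomposable_of_sliding (m := d)
    (F := fun i => (arc d (t + Fin.ofNat n i)).erase (t + Fin.ofNat n d))
    (y := fun i => t + Fin.ofNat n (i + d + 1)) (z := fun i => t + Fin.ofNat n i)
    (fun i hi => ?_) (fun i hi => ?_) (fun i hi j hj hmem => ?_) fun W => ?_
  · have hne := add_ofNat_ne (k := i + d + 1) (l := d) (by omega) (by omega) (by omega) t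
    rw [arc_succ t (by omega), Finset.erase_insert_of_ne hne, Finset.erase_right_comm]
  · exact Finset.mem_erase.2 ⟨add_ofNat_ne (by omega) (by omega) hi.ne t, self_mem_arc _⟩
  · exact notMem_arc t (by omega) hj (Finset.mem_of_mem_erase hmem)
  · rw [mem_link_singleton, mem_arcComplex_iff_exists_le h (Finset.mem_insert_self _ W)]
    simp only [Finset.subset_erase, Finset.insert_subset_iff, mem_arc]
    refine ⟨?_, ?_⟩
    · rintro ⟨hvW, i, hi, -, hW⟩
      exact ⟨i, hi, hW, hvW⟩
    · rintro ⟨i, hi, hW, hvW⟩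
      refine ⟨hvW, i, hi, ?_, hW⟩
      rw [val_sub_add_ofNat (by omega), val_add_ofNat_sub (by omega), if_pos hi]
      exact Nat.sub_le d i

theorem isBuchsbaum_arcComplex {K : Type*} [Field K] (h : 3 * d < n) :
    (arcComplex n d).IsBuchsbaum K :=
  ⟨isPure_arcComplex h,
    fun _ hv => (isVertexDecomposable_link_arcComplex h hv).isShellable.isCohenMacaulay⟩

theorem isVertexDecomposable_deletion_arcComplex_one (h : 3 < n) (v : Fin n) :
    ((arcComplex n 1).deletion v).IsVertexDecomposable := by
  obtain ⟨t, rfl⟩ : ∃ t, v = t + Fin.ofNat n (n - 1) := ⟨v - Fin.ofNat n (n - 1), by simp⟩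
  refine isVertexDecomposable_of_sliding (m := n - 3) (F := fun i => arc 1 (t + Fin.ofNat n i))
    (fun i hi => arc_succ t (by omega)) (fun i _ => self_mem_arc _)
    (fun i hi j hj => notMem_arc t (by omega) hj) fun W => ?_
  rw [mem_deletion, mem_arcComplex_iff_exists_subset_arc (by omega)]
  constructor
  · rintro ⟨⟨s, hs⟩, hv⟩
    have hst := (s - t).isLt
    refine ⟨if (s - t).val = n - 1 then 0 else min (s - t).val (n - 3), by split_ifs <;> omega,
      fun x hx => ?_⟩
    have hxs := mem_arc.1 (hs hx)
    have hxt := (x - t).isLt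
    have hxv : (x - t).val ≠ n - 1 := fun hxv =>
      hv ((eq_add_ofNat_iff (by omega) t x).2 hxv ▸ hx)
    rw [val_sub_eq_ite t] at hxs
    rw [mem_arc, val_sub_add_ofNat (by split_ifs <;> omega)]
    generalize (x - t).val = p at *
    generalize (s - t).val = q at *
    split_ifs at * <;> omega
  · rintro ⟨i, hi, hW⟩
    refine ⟨⟨_, hW⟩, fun hv => ?_⟩
    have hn : n - 1 = n - 3 + 1 + 1 := by omega
    rw [hn] at hv
    exact notMem_arc t (by omega) hi (hW hv)

theorem isVertexDecomposable_arcComplex_one (h : 3 < n) :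
    (arcComplex n 1).IsVertexDecomposable :=
  .shed _ (isPure_arcComplex (by omega)) 0 (singleton_mem_arcComplex 0)
    (isVertexDecomposable_link_arcComplex (by omega) _)
    (isVertexDecomposable_deletion_arcComplex_one h 0)

theorem isClose_iff_ne_add_ofNat (h : n = 2 * d + 2) (a b : Fin n) :
    IsClose d a b ↔ b ≠ a + Fin.ofNat n (d + 1) := by
  rw [ne_eq, eq_add_ofNat_iff (by omega), isClose_iff_val_sub a, sub_self, Fin.val_zero]
  omega

theorem arcComplex_eq_antipodeFree (h : n = 2 * d + 2) :
    arcComplex n d = antipodeFree (· + Fin.ofNat n (d + 1)) Finset.univ := by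
  ext W
  simp only [mem_arcComplex, mem_antipodeFree, isClose_iff_ne_add_ofNat h, Finset.subset_univ,
    true_and]
  exact ⟨fun hW a ha hb => hW a ha _ hb rfl, fun hW a ha b hb hab => hW a ha (hab ▸ hb)⟩

theorem isVertexDecomposable_arcComplex_two_mul_add_two (h : n = 2 * d + 2) :
    (arcComplex n d).IsVertexDecomposable := by
  rw [arcComplex_eq_antipodeFree h]
  refine isVertexDecomposable_antipodeFree (fun x => ?_) (fun x => ?_) Finset.univ
  · have hdouble : Fin.ofNat n (d + 1) + Fin.ofNat n (d + 1) = 0 := by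
      rw [Fin.ext_iff, Fin.val_add, Fin.val_ofNat, Fin.val_zero, ← Nat.add_mod]
      exact Nat.mod_eq_zero_of_dvd ⟨1, by omega⟩
    rw [add_assoc, hdouble, add_zero]
  · rw [ne_comm, ne_eq, eq_add_ofNat_iff (by omega), sub_self, Fin.val_zero]
    omega

variable (n d) in
/-- The set `{0, d} ∪ {n - d, …, 2 * d}`, which for `2 * d + 3 ≤ n ≤ 3 * d` is a facet of
`arcComplex n d` smaller than the arcs. -/
def thinFacet : Finset (Fin n) :=
  Finset.univ.filter fun x => x.val = 0 ∨ x.val = d ∨ (n ≤ x.val + d ∧ x.val ≤ 2 * d)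

theorem mem_thinFacet {x : Fin n} :
    x ∈ thinFacet n d ↔ x.val = 0 ∨ x.val = d ∨ (n ≤ x.val + d ∧ x.val ≤ 2 * d) := by
  simp [thinFacet]

theorem card_thinFacet_le (h : 2 * d + 3 ≤ n) (h' : n ≤ 3 * d) : (thinFacet n d).card ≤ d := by
  have hsub : (thinFacet n d).map Fin.valEmbedding ⊆ {0, d} ∪ Finset.Icc (n - d) (2 * d) := by
    intro k hk
    obtain ⟨x, hx, rfl⟩ := Finset.mem_map.1 hk
    rw [mem_thinFacet] at hx
    simp only [Fin.valEmbedding_apply, Finset.mem_union, Finset.mem_insert, Finset.mem_singleton,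
      Finset.mem_Icc]
    omega
  calc (thinFacet n d).card = ((thinFacet n d).map Fin.valEmbedding).card :=
        (Finset.card_map _).symm
    _ ≤ ({0, d} ∪ Finset.Icc (n - d) (2 * d)).card := Finset.card_le_card hsub
    _ ≤ 2 + (2 * d + 1 - (n - d)) := by
        rw [← Nat.card_Icc]
        exact (Finset.card_union_le _ _).trans (Nat.add_le_add_right Finset.card_le_two _)
    _ ≤ d := by omega

theorem isFacet_thinFacet (h : 2 * d + 2 ≤ n) (h' : n ≤ 3 * d) :
    (arcComplex n d).IsFacet (thinFacet n d) := by
  refine ⟨mem_arcComplex.2 fun a ha b hb => ?_, fun H hH hsub v hv => mem_thinFacet.2 ?_⟩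
  · rw [mem_thinFacet] at ha hb
    rw [isClose_iff_val]
    omega
  · have hclose (k : ℕ) (hk : k < n) (hmem : k = 0 ∨ k = d ∨ (n ≤ k + d ∧ k ≤ 2 * d)) :=
      (isClose_iff_val v ⟨k, hk⟩).1 (mem_arcComplex.1 hH v hv _ (hsub (mem_thinFacet.2 hmem)))
    have hzero := hclose 0 (by omega) (by omega)
    have hd := hclose d (by omega) (by omega)
    have hnd := hclose (n - d) (by omega) (by omega)
    have hfar := hclose (v + (d + 1))
    dsimp only at hzero hd hnd hfar
    omega

theorem not_isPure_arcComplex (h : 2 * d + 3 ≤ n) (h' : n ≤ 3 * d) :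
    ¬ (arcComplex n d).IsPure := by
  intro hpure
  have hcard := hpure (isFacet_arc (by omega) 0) (isFacet_thinFacet (by omega) h')
  rw [card_arc (by omega)] at hcard
  have := card_thinFacet_le h h'
  omega

theorem lt_or_eq_of_isPure_arcComplex (h : 2 * d + 2 ≤ n) (hpure : (arcComplex n d).IsPure) :
    3 * d < n ∨ n = 2 * d + 2 := by
  by_contra! h'
  exact not_isPure_arcComplex (by omega) h'.1 hpure

end Arcs


section Winding

variable {K : Type*} [Field K]

theorem boundary_pair {V : Type*} [LinearOrder V] {a b : V} (hab : a < b) :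
    boundary K (Finsupp.single {a, b} 1) = Finsupp.single {b} 1 - Finsupp.single {a} 1 := by
  have ha : ({a, b} : Finset V).erase a = {b} := Finset.erase_insert (by simpa using hab.ne)
  have hb : ({a, b} : Finset V).erase b = {a} := by
    rw [Finset.pair_comm, Finset.erase_insert (by simpa using hab.ne')]
  rw [boundary_single, Finset.sum_pair hab.ne, ha, hb]
  simp [Finset.filter_insert, Finset.filter_singleton, hab, hab.not_gt, sub_eq_add_neg]

theorem boundary_triple {V : Type*} [LinearOrder V] {a b c : V} (hab : a < b) (hbc : b < c) :
    boundary K (Finsupp.single {a, b, c} 1) =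
      Finsupp.single {b, c} 1 - Finsupp.single {a, c} 1 + Finsupp.single {a, b} 1 := by
  have hac := hab.trans hbc
  have ha : ({a, b, c} : Finset V).erase a = {b, c} :=
    Finset.erase_insert (by simp [hab.ne, hac.ne])
  have hb : ({a, b, c} : Finset V).erase b = {a, c} := by
    rw [Finset.insert_comm, Finset.erase_insert (by simp [hab.ne', hbc.ne])]
  have hc : ({a, b, c} : Finset V).erase c = {a, b} := by
    rw [Finset.pair_comm, Finset.insert_comm, Finset.erase_insert (by simp [hac.ne', hbc.ne'])]
  rw [boundary_single, Finset.sum_insert (by simp [hab.ne, hac.ne]), Finset.sum_pair hbc.ne,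
    ha, hb, hc]
  simp [Finset.filter_insert, Finset.filter_singleton, hab, hbc, hac, hab.not_gt, hbc.not_gt,
    hac.not_gt, hab.ne]
  abel

theorem exists_lt_lt_of_card_eq_three {V : Type*} [LinearOrder V] {T : Finset V}
    (hT : T.card = 3) : ∃ a b c, a < b ∧ b < c ∧ T = {a, b, c} := by
  refine ⟨T.orderEmbOfFin hT 0, T.orderEmbOfFin hT 1, T.orderEmbOfFin hT 2, by simp, by simp, ?_⟩
  have huniv : (Finset.univ : Finset (Fin 3)) = {0, 1, 2} := by decide
  rw [← Finset.image_singleton, ← Finset.image_insert, ← Finset.image_insert, ← huniv,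
    Finset.image_orderEmbOfFin_univ]

open Classical in
variable (K) in
/-- The winding number of a `1`-chain around the `n`-cycle, as a cochain: it counts the edges
`{a, b}` with `a < b` for which the short way from `b` to `a` passes from `n - 1` to `0`. -/
noncomputable def winding (n d : ℕ) : (Finset (Fin n) →₀ K) →ₗ[K] K :=
  Finsupp.linearCombination K fun F => if ∃ a ∈ F, ∃ b ∈ F, a.val + n ≤ b.val + d then 1 else 0

theorem winding_pair {n d : ℕ} {a b : Fin n} (hab : a < b) :
    winding K n d (Finsupp.single {a, b} 1) = if a.val + n ≤ b.val + d then 1 else 0 := by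
  have hlong : (∃ u ∈ ({a, b} : Finset (Fin n)), ∃ v ∈ ({a, b} : Finset (Fin n)),
      u.val + n ≤ v.val + d) ↔ a.val + n ≤ b.val + d := by
    rw [Fin.lt_def] at hab
    simp only [Finset.mem_insert, Finset.mem_singleton, exists_eq_or_imp, exists_eq_left]
    omega
  rw [winding, Finsupp.linearCombination_single, one_smul]
  simp only [hlong]

theorem winding_boundary {n d : ℕ} [NeZero n] (h : 3 * d < n) {c : Finset (Fin n) →₀ K}
    (hc : c ∈ cardChains K (arcComplex n d).faces 3) : winding K n d (boundary K c) = 0 := by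
  suffices hle : cardChains K ((arcComplex n d).faces : Set _) 3 ≤
      LinearMap.ker (winding K n d ∘ₗ boundary K) from hle hc
  rw [cardChains, Finsupp.supported_eq_span_single, Submodule.span_le]
  rintro _ ⟨T, ⟨hT, hcard⟩, rfl⟩
  obtain ⟨x, y, z, hxy, hyz, rfl⟩ := exists_lt_lt_of_card_eq_three hcard
  rw [Finset.mem_coe, mem_arcComplex] at hT
  have hxy' := (isClose_iff_val x y).1 (hT x (by simp) y (by simp))
  have hyz' := (isClose_iff_val y z).1 (hT y (by simp) z (by simp))
  have hxz' := (isClose_iff_val x z).1 (hT x (by simp) z (by simp))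
  rw [SetLike.mem_coe, LinearMap.mem_ker, LinearMap.comp_apply, boundary_triple hxy hyz, map_add,
    map_sub, winding_pair hyz, winding_pair (hxy.trans hyz), winding_pair hxy]
  rw [Fin.lt_def] at hxy hyz
  split_ifs <;> first | omega | simp

variable (K) in
/-- The fundamental cycle of the `(m + 1)`-cycle `0, 1, …, m, 0`. -/
noncomputable def circleCycle (m : ℕ) : Finset (Fin (m + 1)) →₀ K :=
  ∑ i : Fin m, Finsupp.single {i.castSucc, i.succ} 1 - Finsupp.single {0, Fin.last m} 1

variable {m d : ℕ}

theorem boundary_circleCycle (hm : 0 < m) : boundary K (circleCycle K m) = 0 := by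
  have hstep (i : Fin m) : boundary K (Finsupp.single {i.castSucc, i.succ} 1) =
      Finsupp.single {i.succ} 1 - Finsupp.single {i.castSucc} 1 :=
    boundary_pair i.castSucc_lt_succ
  rw [circleCycle, map_sub, map_sum, boundary_pair (Fin.lt_def.2 hm)]
  simp only [hstep, Finset.sum_sub_distrib]
  have hsucc := Fin.sum_univ_succ fun i : Fin (m + 1) =>
    Finsupp.single ({i} : Finset (Fin (m + 1))) (1 : K)
  rw [Fin.sum_univ_castSucc] at hsucc
  rw [sub_sub_sub_eq, sub_eq_zero, hsucc]
  exact add_comm _ _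

theorem circleCycle_mem_cardChains (hd : 1 ≤ d) (hm : 0 < m) :
    circleCycle K m ∈ cardChains K (arcComplex (m + 1) d).faces 2 := by
  have hedge {a b : Fin (m + 1)} (hab : a < b) (hclose : IsClose d a b) :
      Finsupp.single {a, b} 1 ∈ cardChains K ((arcComplex (m + 1) d).faces : Set _) 2 := by
    refine Finsupp.single_mem_supported K _ ⟨mem_arcComplex.2 ?_, Finset.card_pair hab.ne⟩
    simp only [isClose_iff_val] at hclose ⊢
    simp only [Finset.mem_insert, Finset.mem_singleton, forall_eq_or_imp, forall_eq]
    omega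
  refine Submodule.sub_mem _ (Submodule.sum_mem _ fun i _ => hedge i.castSucc_lt_succ ?_)
    (hedge (Fin.lt_def.2 hm) ?_)
  · rw [isClose_iff_val, Fin.val_castSucc, Fin.val_succ]
    omega
  · rw [isClose_iff_val, Fin.val_zero, Fin.val_last]
    omega

theorem winding_circleCycle (hd : 1 ≤ d) (hm : d < m) :
    winding K (m + 1) d (circleCycle K m) = -1 := by
  have hstep (i : Fin m) :
      winding K (m + 1) d (Finsupp.single {i.castSucc, i.succ} 1) = 0 := by
    rw [winding_pair i.castSucc_lt_succ, Fin.val_castSucc, Fin.val_succ, if_neg (by omega)]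
  have hclosing : winding K (m + 1) d (Finsupp.single {0, Fin.last m} 1) = 1 := by
    rw [winding_pair (Fin.lt_def.2 (by simp; omega)), Fin.val_zero, Fin.val_last,
      if_pos (by omega)]
  rw [circleCycle, map_sub, map_sum, hclosing, Finset.sum_eq_zero fun i _ => hstep i, zero_sub]

theorem not_isAcyclicAt_arcComplex {n : ℕ} (hd : 1 ≤ d) (h : 3 * d < n) :
    ¬ IsAcyclicAt K ((arcComplex n d).faces : Set (Finset (Fin n))) 2 := by
  obtain ⟨m, rfl⟩ : ∃ m, n = m + 1 := ⟨n - 1, by omega⟩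
  intro hacyclic
  obtain ⟨c, hc, hbc⟩ := hacyclic
    ⟨circleCycle_mem_cardChains (K := K) hd (by omega), boundary_circleCycle (by omega)⟩
  have hzero := winding_boundary h hc
  rw [hbc, winding_circleCycle hd (by omega)] at hzero
  exact neg_ne_zero.2 one_ne_zero hzero

theorem not_isCohenMacaulay_arcComplex {n : ℕ} [NeZero n] (hd : 2 ≤ d) (h : 3 * d < n) :
    ¬ (arcComplex n d).IsCohenMacaulay K := by
  intro hCM
  have hdim : (arcComplex n d).dim = d := by
    rw [hCM.1.dim_eq (isFacet_arc (by omega) 0), card_arc (by omega)]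
    push_cast
    ring
  have hvanish := hCM.subsingleton_reducedHomology (i := (2 : ℕ) - 1) (by rw [hdim]; omega)
  exact not_isAcyclicAt_arcComplex (by omega) h
    (subsingleton_reducedHomology_iff_isAcyclicAt.1 hvanish)

end Winding

end FinSimplicialComplex

open FinSimplicialComplex

theorem theorem3p3 {K : Type*} [Field K] (n d : ℕ) (hn : 2 * d + 2 ≤ n) (hd : 1 ≤ d)
    (G : SimpleGraph (Fin n)) (hG : G = SimpleGraph.circulant n (Set.Icc (d + 1) (n / 2))) :
    List.TFAE [
      G.independenceComplex.IsBuchsbaum K,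
      G.IsWellCovered,
      3 * d < n ∨ n = 2 * d + 2] ∧
    (G.independenceComplex.IsVertexDecomposable ↔ n = 2 * d + 2 ∨ (d = 1 ∧ 3 < n)) ∧
    (G.independenceComplex.IsShellable ↔ n = 2 * d + 2 ∨ (d = 1 ∧ 3 < n)) ∧
    (G.independenceComplex.IsCohenMacaulay K ↔ n = 2 * d + 2 ∨ (d = 1 ∧ 3 < n)) := by
  subst hG
  have : NeZero n := ⟨by omega⟩
  change List.TFAE [(arcComplex n d).IsBuchsbaum K, _, _] ∧
    ((arcComplex n d).IsVertexDecomposable ↔ _) ∧ ((arcComplex n d).IsShellable ↔ _) ∧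
    ((arcComplex n d).IsCohenMacaulay K ↔ _)
  have hdecomposable (h : n = 2 * d + 2 ∨ (d = 1 ∧ 3 < n)) :
      (arcComplex n d).IsVertexDecomposable := by
    obtain h | ⟨rfl, h⟩ := h
    · exact isVertexDecomposable_arcComplex_two_mul_add_two h
    · exact isVertexDecomposable_arcComplex_one h
  have hCM (h : (arcComplex n d).IsCohenMacaulay K) : n = 2 * d + 2 ∨ (d = 1 ∧ 3 < n) := by
    by_contra! h'
    have hlt := (lt_or_eq_of_isPure_arcComplex hn h.1).resolve_right h'.1
    exact not_isCohenMacaulay_arcComplex (by omega) hlt h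
  refine ⟨?_, ⟨fun h => hCM h.isShellable.isCohenMacaulay, hdecomposable⟩,
    ⟨fun h => hCM h.isCohenMacaulay, fun h => (hdecomposable h).isShellable⟩,
    ⟨hCM, fun h => (hdecomposable h).isShellable.isCohenMacaulay⟩⟩
  tfae_have 1 → 2 := fun h => isPure_independenceComplex_iff_isWellCovered.1 h.1
  tfae_have 2 → 3 := fun h =>
    lt_or_eq_of_isPure_arcComplex hn (isPure_independenceComplex_iff_isWellCovered.2 h)
  tfae_have 3 → 1 := fun h => h.elim isBuchsbaum_arcComplex fun h =>
    (hdecomposable (.inl h)).isShellable.isCohenMacaulay.isBuchsbaum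
  tfae_finish
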